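/- Read "cpo" throughout in either one of two standard senses: (a) a partially ordered set in which every increasing sequence $x_0\le x_1\le\cdots$ has a supremum, or (b) a partially ordered set in which every nonempty directed subset has a supremum. A cpo need not have a least element; it is pointed if it has one. A map between cpo's is Scott-continuous if it is monotone and preserves suprema of increasing sequences in sense (a), of nonempty directed subsets in sense (b); a Scott-continuous map between pointed cpo's is strict if it preserves the least element. Let $\mathbf{DCPO}$ be the category of cpo's and Scott-continuous maps, and $\mathbf{DCPO}_{\perp !}$ the category of pointed cpo's and strict Scott-continuous maps. With the pointwise order on morphisms, in both categories the hom-sets are cpo's and composition is Scott-continuous in each argument. A $\mathbf{DCPO}$-functor between two such categories is a functor whose action on each hom-set is Scott-continuous. An endofunctor $T:\mathbf{C}\to\mathbf{C}$ is algebraically compact if it has an initial algebra $\omega: T\Omega\to\Omega$ such that $\omega^{-1}:\Omega\to T\Omega$ is a final $T$-coalgebra. **Corollary.** For each of the two senses of "cpo" the following holds. Let $T:\mathbf{DCPO}\to\mathbf{DCPO}$ be a $\mathbf{DCPO}$-functor such that $T\cong G\circ F$ for some $\mathbf{DCPO}$-functors $F:\mathbf{DCPO}\to\mathbf{DCPO}_{\perp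 !}$ and $G:\mathbf{DCPO}_{\perp !}\to\mathbf{DCPO}$. Then $T$ is algebraically compact. In particular, the lifting functor $(-)_\perp:\mathbf{DCPO}\to\mathbf{DCPO}$, which freely adds a least element, is algebraically compact. -/

import Mathlib

open CategoryTheory

universe w v u

/-- The two standard meanings of "chain" in the definition of a cpo: increasing sequences
(giving `ω`-complete posets), or nonempty directed sets (giving directed-complete posets; these
are also the posets in which every nonempty totally ordered subset has a supremum). -/
inductive ChainType : Type
  | omega
  | directed

/-- The subsets of a poset whose suprema are considered. -/
def ChainType.IsChainSet (κ : ChainType) {α : Type*} [PartialOrder α] (s : Set α) : Prop :=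
  match κ with
  | .omega => ∃ c : ℕ → α, Monotone c ∧ s = Set.range c
  | .directed => s.Nonempty ∧ DirectedOn (· ≤ ·) s

/-- A complete partial order; it need not have a least element. -/
def IsCpo (κ : ChainType) (α : Type*) [PartialOrder α] : Prop :=
  ∀ s : Set α, κ.IsChainSet s → ∃ a, IsLUB s a

/-- Scott-continuity: monotone and preserving suprema of chains. -/
structure IsScottCont (κ : ChainType) {α β : Type*} [PartialOrder α] [PartialOrder β]
    (f : α → β) : Prop where
  monotone : Monotone f
  isLUB_image : ∀ s : Set α, κ.IsChainSet s → ∀ a, IsLUB s a → IsLUB (f '' s) (f a)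

section Basic

variable {κ : ChainType} {α β γ : Type*} [PartialOrder α] [PartialOrder β] [PartialOrder γ]

theorem ChainType.IsChainSet.nonempty {s : Set α} (hs : κ.IsChainSet s) : s.Nonempty := by
  cases κ with
  | omega => obtain ⟨c, -, rfl⟩ := hs; exact Set.range_nonempty c
  | directed => exact hs.1

theorem ChainType.IsChainSet.image {s : Set α} (hs : κ.IsChainSet s) {f : α → β}
    (hf : Monotone f) : κ.IsChainSet (f '' s) := by
  cases κ with
  | omega =>
    obtain ⟨c, hc, rfl⟩ := hs
    exact ⟨f ∘ c, hf.comp hc, (Set.range_comp f c).symm⟩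
  | directed =>
    refine ⟨hs.1.image f, ?_⟩
    rintro _ ⟨x, hx, rfl⟩ _ ⟨y, hy, rfl⟩
    obtain ⟨z, hz, hxz, hyz⟩ := hs.2 x hx y hy
    exact ⟨f z, ⟨z, hz, rfl⟩, hf hxz, hf hyz⟩

theorem IsScottCont.id : IsScottCont κ (fun x : α => x) where
  monotone := monotone_id
  isLUB_image s _ a ha := by simpa using ha

theorem IsScottCont.comp {g : β → γ} {f : α → β} (hg : IsScottCont κ g) (hf : IsScottCont κ f) :
    IsScottCont κ (fun x => g (f x)) where
  monotone := hg.monotone.comp hf.monotone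
  isLUB_image s hs a ha := by
    have h := hg.isLUB_image _ (hs.image hf.monotone) _ (hf.isLUB_image s hs a ha)
    rwa [Set.image_image] at h

/-- A pointwise supremum of Scott-continuous functions is Scott-continuous. -/
theorem IsScottCont.of_pointwise_isLUB {ι : Type*} (s : Set ι) (F : ι → α → β)
    (hF : ∀ i ∈ s, IsScottCont κ (F i)) {g : α → β}
    (hg : ∀ x, IsLUB ((fun i => F i x) '' s) (g x)) : IsScottCont κ g := by
  have hle : ∀ i ∈ s, ∀ x, F i x ≤ g x := fun i hi x => (hg x).1 ⟨i, hi, rfl⟩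
  have hmono : Monotone g := by
    intro x y hxy
    refine (hg x).2 ?_
    rintro _ ⟨i, hi, rfl⟩
    exact ((hF i hi).monotone hxy).trans (hle i hi y)
  refine ⟨hmono, fun A hA a ha => ⟨?_, fun b hb => (hg a).2 ?_⟩⟩
  · rintro _ ⟨x, hx, rfl⟩
    exact hmono (ha.1 hx)
  · rintro _ ⟨i, hi, rfl⟩
    refine ((hF i hi).isLUB_image A hA a ha).2 ?_
    rintro _ ⟨x, hx, rfl⟩
    exact (hle i hi x).trans (hb ⟨x, hx, rfl⟩)

end Basic

/-- An object of the category of cpo's. -/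
structure Cpo (κ : ChainType) : Type (u + 1) where
  carrier : Type u
  [order : PartialOrder carrier]
  complete : IsCpo κ carrier

/-- An object of the category of pointed cpo's. -/
structure PointedCpo (κ : ChainType) : Type (u + 1) where
  carrier : Type u
  [order : PartialOrder carrier]
  [bot : OrderBot carrier]
  complete : IsCpo κ carrier

attribute [instance] Cpo.order PointedCpo.order PointedCpo.bot

/-- Scott-continuous functions. -/
@[ext]
structure Cpo.Hom {κ : ChainType} (X Y : Cpo.{u} κ) : Type u where
  toFun : X.carrier → Y.carrier
  cont : IsScottCont κ toFun

/-- Strict Scott-continuous functions. -/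
@[ext]
structure PointedCpo.Hom {κ : ChainType} (X Y : PointedCpo.{u} κ) : Type u where
  toFun : X.carrier → Y.carrier
  cont : IsScottCont κ toFun
  strict : toFun ⊥ = ⊥

instance Cpo.category (κ : ChainType) : Category.{u} (Cpo.{u} κ) where
  Hom X Y := Cpo.Hom X Y
  id _ := ⟨fun x => x, IsScottCont.id⟩
  comp f g := ⟨fun x => g.toFun (f.toFun x), g.cont.comp f.cont⟩

instance PointedCpo.category (κ : ChainType) : Category.{u} (PointedCpo.{u} κ) where
  Hom X Y := PointedCpo.Hom X Y
  id _ := ⟨fun x => x, IsScottCont.id, rfl⟩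
  comp f g := ⟨fun x => g.toFun (f.toFun x), g.cont.comp f.cont, by rw [f.strict, g.strict]⟩

/-- A partial order on each hom-set of a category. -/
class HomOrder (C : Type w) [Category.{v} C] where
  order : ∀ X Y : C, PartialOrder (X ⟶ Y)

attribute [reducible, instance] HomOrder.order

/-- A category enriched in cpo's: the hom-sets are cpo's and composition is Scott-continuous
in both arguments. -/
class CpoCategory (κ : ChainType) (C : Type w) [Category.{v} C] [HomOrder C] : Prop where
  complete : ∀ X Y : C, IsCpo κ (X ⟶ Y)
  comp_left : ∀ {X Y Z : C} (g : Y ⟶ Z), IsScottCont κ (fun f : X ⟶ Y => f ≫ g)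
  comp_right : ∀ {X Y Z : C} (f : X ⟶ Y), IsScottCont κ (fun g : Y ⟶ Z => f ≫ g)

/-- A functor between categories enriched in cpo's whose action on hom-cpo's is
Scott-continuous. -/
structure CpoFunctor (κ : ChainType)
    (C : Type*) [Category* C] [HomOrder C] [CpoCategory κ C]
    (D : Type*) [Category* D] [HomOrder D] [CpoCategory κ D] extends C ⥤ D where
  cont : ∀ X Y : C, IsScottCont κ (fun f : X ⟶ Y => toFunctor.map f)

/-- There is an initial `T`-algebra `ω : T Ω ⟶ Ω` (necessarily an isomorphism) such that
`ω⁻¹ : Ω ⟶ T Ω` is a final `T`-coalgebra. -/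
def IsAlgebraicallyCompact {C : Type*} [Category* C] (T : C ⥤ C) : Prop :=
  ∃ (Ω : C) (ω : T.obj Ω ≅ Ω),
    Nonempty (Limits.IsInitial (Endofunctor.Algebra.mk (F := T) Ω ω.hom)) ∧
    Nonempty (Limits.IsTerminal (Endofunctor.Coalgebra.mk (F := T) Ω ω.inv))

/-- An enriched endofunctor is algebraically compact if its underlying endofunctor is. -/
def CpoFunctor.AlgebraicallyCompact {κ : ChainType} {C : Type*} [Category* C] [HomOrder C]
    [CpoCategory κ C] (T : CpoFunctor κ C C) : Prop :=
  IsAlgebraicallyCompact T.toFunctor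

/-- `T` is isomorphic to `G ∘ F` for enriched functors `F : C ⥤ D` and `G : D ⥤ C`. -/
def CpoFunctor.FactorsThrough {κ : ChainType} {C : Type*} [Category* C] [HomOrder C]
    [CpoCategory κ C] (T : CpoFunctor κ C C)
    (D : Type*) [Category* D] [HomOrder D] [CpoCategory κ D] : Prop :=
  ∃ (F : CpoFunctor κ C D) (G : CpoFunctor κ D C),
    Nonempty (T.toFunctor ≅ F.toFunctor ⋙ G.toFunctor)

/-! The pointwise order on morphisms, and the resulting enriched categories. -/

instance Cpo.homOrder (κ : ChainType) : HomOrder (Cpo.{u} κ) where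
  order X Y :=
    { le := fun f g => ∀ x, f.toFun x ≤ g.toFun x
      le_refl := fun _ _ => le_rfl
      le_trans := fun _ _ _ h k x => (h x).trans (k x)
      le_antisymm := fun _ _ h k => Cpo.Hom.ext (funext fun x => (h x).antisymm (k x)) }

instance PointedCpo.homOrder (κ : ChainType) : HomOrder (PointedCpo.{u} κ) where
  order X Y :=
    { le := fun f g => ∀ x, f.toFun x ≤ g.toFun x
      le_refl := fun _ _ => le_rfl
      le_trans := fun _ _ _ h k x => (h x).trans (k x)
      le_antisymm := fun _ _ h k => PointedCpo.Hom.ext (funext fun x => (h x).antisymm (k x)) }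

theorem Cpo.isLUB_of_pointwise {κ : ChainType} {X Y : Cpo.{u} κ} {s : Set (X ⟶ Y)} {g : X ⟶ Y}
    (h : ∀ x, IsLUB ((fun f : X ⟶ Y => f.toFun x) '' s) (g.toFun x)) : IsLUB s g := by
  refine ⟨fun f hf x => (h x).1 ⟨f, hf, rfl⟩, fun k hk x => (h x).2 ?_⟩
  rintro _ ⟨f, hf, rfl⟩
  exact hk hf x

theorem PointedCpo.isLUB_of_pointwise {κ : ChainType} {X Y : PointedCpo.{u} κ}
    {s : Set (X ⟶ Y)} {g : X ⟶ Y}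
    (h : ∀ x, IsLUB ((fun f : X ⟶ Y => f.toFun x) '' s) (g.toFun x)) : IsLUB s g := by
  refine ⟨fun f hf x => (h x).1 ⟨f, hf, rfl⟩, fun k hk x => (h x).2 ?_⟩
  rintro _ ⟨f, hf, rfl⟩
  exact hk hf x

theorem Cpo.exists_pointwise {κ : ChainType} {X Y : Cpo.{u} κ} {s : Set (X ⟶ Y)}
    (hs : κ.IsChainSet s) :
    ∃ g : X ⟶ Y, ∀ x, IsLUB ((fun f : X ⟶ Y => f.toFun x) '' s) (g.toFun x) := by
  have h : ∀ x, ∃ a, IsLUB ((fun f : X ⟶ Y => f.toFun x) '' s) a := fun x =>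
    Y.complete _ (hs.image fun _ _ hfg => hfg x)
  choose g hg using h
  exact ⟨⟨g, .of_pointwise_isLUB s (fun f : X ⟶ Y => f.toFun) (fun f _ => f.cont) hg⟩, hg⟩

theorem PointedCpo.exists_pointwise {κ : ChainType} {X Y : PointedCpo.{u} κ} {s : Set (X ⟶ Y)}
    (hs : κ.IsChainSet s) :
    ∃ g : X ⟶ Y, ∀ x, IsLUB ((fun f : X ⟶ Y => f.toFun x) '' s) (g.toFun x) := by
  have h : ∀ x, ∃ a, IsLUB ((fun f : X ⟶ Y => f.toFun x) '' s) a := fun x =>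
    Y.complete _ (hs.image fun _ _ hfg => hfg x)
  choose g hg using h
  refine ⟨⟨g, .of_pointwise_isLUB s (fun f : X ⟶ Y => f.toFun) (fun f _ => f.cont) hg, ?_⟩, hg⟩
  refine le_bot_iff.1 ((hg ⊥).2 ?_)
  rintro _ ⟨f, -, rfl⟩
  exact f.strict.le

/-- Suprema of chains of morphisms are computed pointwise. -/
theorem Cpo.isLUB_pointwise {κ : ChainType} {X Y : Cpo.{u} κ} {s : Set (X ⟶ Y)}
    (hs : κ.IsChainSet s) {g : X ⟶ Y} (hg : IsLUB s g) (x : X.carrier) :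
    IsLUB ((fun f : X ⟶ Y => f.toFun x) '' s) (g.toFun x) := by
  obtain ⟨k, hk⟩ := Cpo.exists_pointwise hs
  rw [hg.unique (Cpo.isLUB_of_pointwise hk)]
  exact hk x

theorem PointedCpo.isLUB_pointwise {κ : ChainType} {X Y : PointedCpo.{u} κ} {s : Set (X ⟶ Y)}
    (hs : κ.IsChainSet s) {g : X ⟶ Y} (hg : IsLUB s g) (x : X.carrier) :
    IsLUB ((fun f : X ⟶ Y => f.toFun x) '' s) (g.toFun x) := by
  obtain ⟨k, hk⟩ := PointedCpo.exists_pointwise hs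
  rw [hg.unique (PointedCpo.isLUB_of_pointwise hk)]
  exact hk x

instance Cpo.cpoCategory (κ : ChainType) : CpoCategory κ (Cpo.{u} κ) where
  complete X Y s hs := by
    obtain ⟨g, hg⟩ := Cpo.exists_pointwise hs
    exact ⟨g, Cpo.isLUB_of_pointwise hg⟩
  comp_left {X Y Z} g :=
    { monotone := fun _ _ h x => g.cont.monotone (h x)
      isLUB_image := fun s hs a ha => Cpo.isLUB_of_pointwise fun x => by
        have h := g.cont.isLUB_image _
          (hs.image (f := fun f : X ⟶ Y => f.toFun x) fun _ _ h => h x) _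
          (Cpo.isLUB_pointwise hs ha x)
        rw [Set.image_image] at h ⊢
        exact h }
  comp_right {X Y Z} f :=
    { monotone := fun _ _ h x => h (f.toFun x)
      isLUB_image := fun s hs a ha => Cpo.isLUB_of_pointwise fun x => by
        rw [Set.image_image]
        exact Cpo.isLUB_pointwise hs ha (f.toFun x) }

instance PointedCpo.cpoCategory (κ : ChainType) : CpoCategory κ (PointedCpo.{u} κ) where
  complete X Y s hs := by
    obtain ⟨g, hg⟩ := PointedCpo.exists_pointwise hs
    exact ⟨g, PointedCpo.isLUB_of_pointwise hg⟩
  comp_left {X Y Z} g :=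
    { monotone := fun _ _ h x => g.cont.monotone (h x)
      isLUB_image := fun s hs a ha => PointedCpo.isLUB_of_pointwise fun x => by
        have h := g.cont.isLUB_image _
          (hs.image (f := fun f : X ⟶ Y => f.toFun x) fun _ _ h => h x) _
          (PointedCpo.isLUB_pointwise hs ha x)
        rw [Set.image_image] at h ⊢
        exact h }
  comp_right {X Y Z} f :=
    { monotone := fun _ _ h x => h (f.toFun x)
      isLUB_image := fun s hs a ha => PointedCpo.isLUB_of_pointwise fun x => by
        rw [Set.image_image]
        exact PointedCpo.isLUB_pointwise hs ha (f.toFun x) }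

/-! Lifting: freely adding a least element. -/

section Lifting

variable {κ : ChainType} {α β : Type*} [PartialOrder α] [PartialOrder β]

theorem ChainType.IsChainSet.withBot {s : Set (WithBot α)} (hs : κ.IsChainSet s) :
    s = {⊥} ∨ κ.IsChainSet {x : α | (x : WithBot α) ∈ s} := by
  classical
  by_cases h : ∃ x : α, (x : WithBot α) ∈ s
  · right
    cases κ with
    | omega =>
      obtain ⟨c, hc, rfl⟩ := hs
      have hex : ∃ n, c n ≠ ⊥ := by
        obtain ⟨x, n, hn⟩ := h
        exact ⟨n, by simp [hn]⟩
      have hne : ∀ n, c (Nat.find hex + n) ≠ ⊥ := fun n hn =>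
        Nat.find_spec hex (le_bot_iff.1 ((hc (Nat.le_add_right _ n)).trans hn.le))
      refine ⟨fun n => (c (Nat.find hex + n)).unbot (hne n), fun i j hij => ?_, ?_⟩
      · rw [← WithBot.coe_le_coe, WithBot.coe_unbot, WithBot.coe_unbot]
        exact hc (by omega)
      · ext x
        constructor
        · rintro ⟨n, hn⟩
          have hle : Nat.find hex ≤ n := Nat.find_le (h := hex) (by simp [hn])
          refine ⟨n - Nat.find hex, ?_⟩
          rw [← WithBot.coe_inj, WithBot.coe_unbot, Nat.add_sub_cancel' hle, hn]
        · rintro ⟨n, rfl⟩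
          exact ⟨Nat.find hex + n, by simp⟩
    | directed =>
      refine ⟨h, fun x hx y hy => ?_⟩
      obtain ⟨z, hz, hxz, hyz⟩ := hs.2 _ hx _ hy
      obtain ⟨z, rfl⟩ := WithBot.ne_bot_iff_exists.1 fun hb : z = ⊥ => by simp [hb] at hxz
      exact ⟨z, hz, WithBot.coe_le_coe.1 hxz, WithBot.coe_le_coe.1 hyz⟩
  · left
    refine hs.nonempty.subset_singleton_iff.1 fun y hy => ?_
    by_contra hne
    obtain ⟨x, rfl⟩ := WithBot.ne_bot_iff_exists.1 hne
    exact h ⟨x, hy⟩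

theorem isLUB_withBot_iff {s : Set (WithBot α)} (hs : {x : α | (x : WithBot α) ∈ s}.Nonempty)
    {a : α} : IsLUB s (a : WithBot α) ↔ IsLUB {x : α | (x : WithBot α) ∈ s} a := by
  constructor
  · refine fun h => ⟨fun x hx => WithBot.coe_le_coe.1 (h.1 hx), fun b hb => ?_⟩
    refine WithBot.coe_le_coe.1 (h.2 fun y hy => ?_)
    induction y using WithBot.recBotCoe with
    | bot => exact bot_le
    | coe y => exact WithBot.coe_le_coe.2 (hb hy)
  · refine fun h => ⟨fun y hy => ?_, fun b hb => ?_⟩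
    · induction y using WithBot.recBotCoe with
      | bot => exact bot_le
      | coe y => exact WithBot.coe_le_coe.2 (h.1 hy)
    · obtain ⟨x, hx⟩ := hs
      obtain ⟨b, rfl⟩ := WithBot.ne_bot_iff_exists.1 fun hn : b = ⊥ => by
        simpa [hn] using hb hx
      exact WithBot.coe_le_coe.2 (h.2 fun y hy => WithBot.coe_le_coe.1 (hb hy))

theorem IsCpo.withBot (h : IsCpo κ α) : IsCpo κ (WithBot α) := by
  intro s hs
  rcases hs.withBot with rfl | ht
  · exact ⟨⊥, isLUB_singleton⟩
  · obtain ⟨a, ha⟩ := h _ ht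
    exact ⟨a, (isLUB_withBot_iff ht.nonempty).2 ha⟩

theorem IsScottCont.withBot_map {f : α → β} (hf : IsScottCont κ f) :
    IsScottCont κ (WithBot.map f) where
  monotone := hf.monotone.withBot_map
  isLUB_image s hs a ha := by
    rcases hs.withBot with rfl | ht
    · rw [ha.unique isLUB_singleton, Set.image_singleton]
      exact isLUB_singleton
    · obtain ⟨x, hx⟩ := ht.nonempty
      obtain ⟨a, rfl⟩ := WithBot.ne_bot_iff_exists.1 fun hn : a = ⊥ => by
        simpa [hn] using ha.1 hx
      have key : {y : β | (y : WithBot β) ∈ WithBot.map f '' s} =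
          f '' {x : α | (x : WithBot α) ∈ s} := by
        ext y
        constructor
        · rintro ⟨z, hz, hzy⟩
          induction z using WithBot.recBotCoe with
          | bot => simp at hzy
          | coe z => exact ⟨z, hz, WithBot.coe_inj.1 hzy⟩
        · rintro ⟨z, hz, rfl⟩
          exact ⟨z, hz, rfl⟩
      rw [WithBot.map_coe, isLUB_withBot_iff (by rw [key]; exact ⟨_, x, hx, rfl⟩), key]
      exact hf.isLUB_image _ ht _ ((isLUB_withBot_iff ht.nonempty).1 ha)

end Lifting

/-- The lifting functor, sending `X` to `X` with a new least element. -/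
def liftingFunctor (κ : ChainType) : CpoFunctor κ (Cpo.{u} κ) (Cpo.{u} κ) where
  obj X := ⟨WithBot X.carrier, X.complete.withBot⟩
  map f := ⟨WithBot.map f.toFun, f.cont.withBot_map⟩
  map_id X := Cpo.Hom.ext WithBot.map_id
  map_comp f g := Cpo.Hom.ext (WithBot.map_comp_map f.toFun g.toFun).symm
  cont X Y :=
    { monotone := fun f g h x => by
        induction x using WithBot.recBotCoe with
        | bot => exact le_rfl
        | coe x => exact WithBot.coe_le_coe.2 (h x)
      isLUB_image := fun s hs g hg => Cpo.isLUB_of_pointwise fun x => by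
        rw [Set.image_image]
        induction x using WithBot.recBotCoe with
        | bot =>
          change IsLUB ((fun _ => (⊥ : WithBot Y.carrier)) '' s) ⊥
          rw [hs.nonempty.image_const]
          exact isLUB_singleton
        | coe x =>
          have key : {y : Y.carrier | (y : WithBot Y.carrier) ∈
              (fun f : X ⟶ Y => ((f.toFun x : Y.carrier) : WithBot Y.carrier)) '' s} =
              (fun f : X ⟶ Y => f.toFun x) '' s := by
            ext y
            simp
          change IsLUB ((fun f : X ⟶ Y => ((f.toFun x : Y.carrier) : WithBot Y.carrier)) '' s)
            ((g.toFun x : Y.carrier) : WithBot Y.carrier)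
          rw [isLUB_withBot_iff (by rw [key]; exact hs.nonempty.image _), key]
          exact Cpo.isLUB_pointwise hs hg x }

/-! Increasing sequences and least fixed points. -/

section Sequences

variable {κ : ChainType} {α β : Type*} [PartialOrder α] [PartialOrder β]

/-! Algebraic compactness passes from `G ⋙ F` to `F ⋙ G` (`IsAlgebraicallyCompact.comp_swap`), so it
suffices to treat enriched endofunctors `H` of pointed cpo's. For these the limit-colimit
coincidence applies. The iterates of `H` on the one-point cpo are linked by embeddings and
projections. Their limit along the projections is a fixed point of `H` on which the identity is the
supremum of the approximations "project to stage `n`, then embed back" (`isLUB_bilimApprox`,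
`exists_bilimIso`).

On such a fixed point, Kleene's theorem yields morphisms to every algebra and from every coalgebra.
Composing a competitor with the approximations gives exactly the Kleene iterates, which proves
uniqueness (`isAlgebraicallyCompact_of_isLUB`).

Only suprema of sequences are used in these limit arguments. The range of an increasing sequence is
a chain in both senses of "cpo", so one proof covers both. -/

theorem ChainType.isChainSet_range (κ : ChainType) {c : ℕ → α} (hc : Monotone c) :
    κ.IsChainSet (Set.range c) := by
  cases κ with
  | omega => exact ⟨c, hc, rfl⟩
  | directed =>
    refine ⟨Set.range_nonempty c, ?_⟩
    rintro _ ⟨i, rfl⟩ _ ⟨j, rfl⟩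
    exact ⟨_, ⟨max i j, rfl⟩, hc (le_max_left i j), hc (le_max_right i j)⟩

theorem IsScottCont.isLUB_range {f : α → β} (hf : IsScottCont κ f) {c : ℕ → α} (hc : Monotone c)
    {a : α} (ha : IsLUB (Set.range c) a) : IsLUB (Set.range fun n => f (c n)) (f a) := by
  have h := hf.isLUB_image _ (κ.isChainSet_range hc) a ha
  rwa [← Set.range_comp] at h

theorem isLUB_range_succ {c : ℕ → α} (hc : Monotone c) {a : α} :
    IsLUB (Set.range fun n => c (n + 1)) a ↔ IsLUB (Set.range c) a := by
  have h : upperBounds (Set.range fun n => c (n + 1)) = upperBounds (Set.range c) := by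
    ext b
    simp only [mem_upperBounds, Set.forall_mem_range]
    exact ⟨fun h n => (hc n.le_succ).trans (h n), fun h n => h _⟩
  rw [IsLUB, IsLUB, h]

/-- Kleene's fixed point theorem. -/
theorem IsScottCont.exists_fixedPoint (hα : IsCpo κ α) {Φ : α → α} (hΦ : IsScottCont κ Φ)
    {b : α} (hb : ∀ x, b ≤ x) :
    ∃ x, IsLUB (Set.range fun n => Φ^[n] b) x ∧ Φ x = x := by
  have hc : Monotone fun n => Φ^[n] b := hΦ.monotone.monotone_iterate_of_le_map (hb _)
  obtain ⟨x, hx⟩ := hα _ (κ.isChainSet_range hc)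
  refine ⟨x, hx, IsLUB.unique (hΦ.isLUB_range hc hx) ?_⟩
  simpa only [Function.iterate_succ_apply'] using (isLUB_range_succ hc).2 hx

end Sequences

/-! Algebraic compactness of composites. -/

section AlgebraicCompactness

universe v₁ v₂ u₁ u₂

variable {C : Type u₁} [Category.{v₁} C] {D : Type u₂} [Category.{v₂} D]

theorem isAlgebraicallyCompact_iff {T : C ⥤ C} :
    IsAlgebraicallyCompact T ↔ ∃ (Ω : C) (ω : T.obj Ω ≅ Ω),
      (∀ (A : C) (a : T.obj A ⟶ A), ∃! f : Ω ⟶ A, ω.hom ≫ f = T.map f ≫ a) ∧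
      (∀ (A : C) (c : A ⟶ T.obj A), ∃! f : A ⟶ Ω, f ≫ ω.inv = c ≫ T.map f) := by
  constructor
  · rintro ⟨Ω, ω, ⟨hi⟩, ⟨ht⟩⟩
    refine ⟨Ω, ω, fun A a => ?_, fun A c => ?_⟩
    · refine ⟨(hi.to ⟨A, a⟩).f, (hi.to ⟨A, a⟩).h.symm, fun f hf => ?_⟩
      exact congrArg Endofunctor.Algebra.Hom.f
        (hi.hom_ext (Endofunctor.Algebra.Hom.mk f hf.symm : _ ⟶ ⟨A, a⟩) (hi.to _))
    · refine ⟨(ht.from ⟨A, c⟩).f, (ht.from ⟨A, c⟩).h.symm, fun f hf => ?_⟩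
      exact congrArg Endofunctor.Coalgebra.Hom.f
        (ht.hom_ext (Endofunctor.Coalgebra.Hom.mk f hf.symm : ⟨A, c⟩ ⟶ _) (ht.from _))
  · rintro ⟨Ω, ω, hi, ht⟩
    choose i hi hi' using hi
    choose t ht ht' using ht
    refine ⟨Ω, ω, ⟨Limits.IsInitial.ofUniqueHom (fun A => ⟨i A.1 A.str, (hi A.1 A.str).symm⟩)
      fun A f => ?_⟩, ⟨Limits.IsTerminal.ofUniqueHom
        (fun A => ⟨t A.1 A.str, (ht A.1 A.str).symm⟩) fun A f => ?_⟩⟩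
    · exact Endofunctor.Algebra.Hom.ext (hi' A.1 A.str f.f f.h.symm)
    · exact Endofunctor.Coalgebra.Hom.ext (ht' A.1 A.str f.f f.h.symm)

theorem IsAlgebraicallyCompact.of_iso {S T : C ⥤ C} (α : T ≅ S) (hS : IsAlgebraicallyCompact S) :
    IsAlgebraicallyCompact T := by
  obtain ⟨Ω, ω, hi, ht⟩ := isAlgebraicallyCompact_iff.1 hS
  refine isAlgebraicallyCompact_iff.2 ⟨Ω, α.app Ω ≪≫ ω, fun A a => ?_, fun A c => ?_⟩
  · refine (existsUnique_congr fun f => ?_).1 (hi A (α.inv.app A ≫ a))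
    rw [← cancel_epi (α.hom.app Ω)]
    simp
  · refine (existsUnique_congr fun f => ?_).1 (ht A (c ≫ α.hom.app A))
    rw [← cancel_mono (α.inv.app Ω)]
    simp

/-- `F` turns an algebra `a` on `A` into an algebra `F.map a` on `F.obj A` for the other composite.
If `u` is the morphism induced there, `G.map u ≫ a` is the one required. Coalgebras are dual. -/
theorem IsAlgebraicallyCompact.comp_swap {F : C ⥤ D} {G : D ⥤ C}
    (h : IsAlgebraicallyCompact (G ⋙ F)) : IsAlgebraicallyCompact (F ⋙ G) := by
  obtain ⟨Ω, ω, hi, ht⟩ := isAlgebraicallyCompact_iff.1 h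
  refine isAlgebraicallyCompact_iff.2 ⟨G.obj Ω, G.mapIso ω, fun A a => ?_, fun A c => ?_⟩
  · obtain ⟨u, hu, huniq⟩ := hi (F.obj A) (F.map a)
    dsimp at hu huniq a ⊢
    refine ⟨G.map u ≫ a, ?_, fun v hv => ?_⟩
    · dsimp only
      rw [← G.map_comp_assoc, hu]
      simp
    -- Any competitor `v` is determined by `ω.inv ≫ F.map v`, which is itself an algebra morphism
    -- and hence equals `u`.
    · have hv' : v = G.map (ω.inv ≫ F.map v) ≫ a := by
        rw [G.map_comp, Category.assoc, ← hv, ← G.map_comp_assoc]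
        simp
      rw [← huniq (ω.inv ≫ F.map v) ?_]
      · exact hv'
      · rw [← F.map_comp, ← hv']
        simp
  · obtain ⟨u, hu, huniq⟩ := ht (F.obj A) (F.map c)
    dsimp at hu huniq c ⊢
    refine ⟨c ≫ G.map u, ?_, fun v hv => ?_⟩
    · dsimp only
      rw [Category.assoc, ← G.map_comp, hu]
      simp
    · have hv' : v = c ≫ G.map (F.map v ≫ ω.hom) := by
        rw [G.map_comp, ← Category.assoc, ← hv, Category.assoc, ← G.map_comp]
        simp
      rw [← huniq (F.map v ≫ ω.hom) ?_]
      · exact hv'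
      · rw [← F.map_comp, ← hv']
        simp

end AlgebraicCompactness

theorem CpoCategory.comp_le_comp {κ : ChainType} {C : Type*} [Category* C] [HomOrder C]
    [CpoCategory κ C] {X Y Z : C} {f f' : X ⟶ Y} {g g' : Y ⟶ Z} (hf : f ≤ f') (hg : g ≤ g') :
    f ≫ g ≤ f' ≫ g' :=
  ((CpoCategory.comp_left (κ := κ) g).monotone hf).trans
    ((CpoCategory.comp_right (κ := κ) f').monotone hg)

namespace CpoFunctor

universe v₁ v₂ v₃ u₁ u₂ u₃

/-- The composite of two enriched functors. -/
def comp {κ : ChainType} {C : Type u₁} [Category.{v₁} C] [HomOrder C] [CpoCategory κ C]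
    {D : Type u₂} [Category.{v₂} D] [HomOrder D] [CpoCategory κ D]
    {E : Type u₃} [Category.{v₃} E] [HomOrder E] [CpoCategory κ E]
    (F : CpoFunctor κ C D) (G : CpoFunctor κ D E) : CpoFunctor κ C E where
  toFunctor := F.toFunctor ⋙ G.toFunctor
  cont X Y := (G.cont _ _).comp (F.cont X Y)

end CpoFunctor

/-! ### Zero morphisms and fixed points of endofunctors of pointed cpo's -/

namespace PointedCpo

variable {κ : ChainType}

/-- The constant morphism with value `⊥`. -/
def zero (X Y : PointedCpo.{u} κ) : X ⟶ Y :=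
  Hom.mk (fun _ => ⊥)
    { monotone := fun _ _ _ => le_rfl
      isLUB_image := fun s hs a _ => by
        rw [hs.nonempty.image_const]
        exact isLUB_singleton } rfl

theorem zero_le {X Y : PointedCpo.{u} κ} (f : X ⟶ Y) : zero X Y ≤ f :=
  fun _ => bot_le

/-- Strictness enters here; in the uniqueness argument for algebras it makes the approximations,
composed with a competitor, start at the bottom of the hom-cpo. -/
theorem zero_comp {X Y Z : PointedCpo.{u} κ} (f : Y ⟶ Z) : zero X Y ≫ f = zero X Z :=
  Hom.ext (funext fun _ => f.strict)

theorem comp_zero {X Y Z : PointedCpo.{u} κ} (f : X ⟶ Y) : f ≫ zero Y Z = zero X Z :=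
  rfl

/-- The one-element cpo. -/
def unit (κ : ChainType) : PointedCpo.{u} κ where
  carrier := PUnit
  complete _ _ := ⟨PUnit.unit, fun _ _ => le_rfl, fun _ _ => le_rfl⟩

theorem eq_of_to_unit {X : PointedCpo.{u} κ} (f g : X ⟶ unit κ) : f = g :=
  Hom.ext (funext fun _ => rfl)

/-- A fixed point of an enriched endofunctor for which the identity is the supremum of the
canonical chain of approximations is an initial algebra and a final coalgebra. -/
theorem isAlgebraicallyCompact_of_isLUB (H : CpoFunctor κ (PointedCpo.{u} κ) (PointedCpo.{u} κ))
    {Ω : PointedCpo.{u} κ} (ω : H.obj Ω ≅ Ω) (δ : ℕ → (Ω ⟶ Ω)) (hδ : Monotone δ)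
    (h0 : δ 0 = zero Ω Ω) (hsucc : ∀ n, δ (n + 1) = ω.inv ≫ H.map (δ n) ≫ ω.hom)
    (hid : IsLUB (Set.range δ) (𝟙 Ω)) : IsAlgebraicallyCompact H.toFunctor := by
  refine isAlgebraicallyCompact_iff.2 ⟨Ω, ω, fun A a => ?_, fun A c => ?_⟩
  · have hΦ : IsScottCont κ fun f : Ω ⟶ A => ω.inv ≫ H.map f ≫ a :=
      (CpoCategory.comp_right ω.inv).comp ((CpoCategory.comp_left a).comp (H.cont Ω A))
    obtain ⟨f, hf, hfix⟩ := hΦ.exists_fixedPoint (CpoCategory.complete Ω A) zero_le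
    refine ⟨f, (Iso.eq_inv_comp ω).1 hfix.symm, fun g hg => IsLUB.unique ?_ hf⟩
    have hg' : IsLUB _ (𝟙 Ω ≫ g) :=
      (CpoCategory.comp_left (κ := κ) g).isLUB_range hδ hid
    rw [Category.id_comp] at hg'
    -- It remains to see that the `n`-th Kleene iterate is `δ n ≫ g`.
    convert hg' using 3 with n
    induction n with
    | zero => rw [h0, zero_comp, Function.iterate_zero_apply]
    | succ n ih =>
      rw [Function.iterate_succ_apply', ih, hsucc]
      simp only [Category.assoc, hg, H.map_comp]
  · have hΦ : IsScottCont κ fun f : A ⟶ Ω => c ≫ H.map f ≫ ω.hom :=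
      (CpoCategory.comp_right c).comp ((CpoCategory.comp_left ω.hom).comp (H.cont A Ω))
    obtain ⟨f, hf, hfix⟩ := hΦ.exists_fixedPoint (CpoCategory.complete A Ω) zero_le
    refine ⟨f, (Iso.comp_inv_eq ω).2 (by rw [Category.assoc]; exact hfix.symm),
      fun g hg => IsLUB.unique ?_ hf⟩
    have hg' : IsLUB _ (g ≫ 𝟙 Ω) :=
      (CpoCategory.comp_right (κ := κ) g).isLUB_range hδ hid
    rw [Category.comp_id] at hg'
    convert hg' using 3 with n
    induction n with
    | zero => rw [h0, comp_zero, Function.iterate_zero_apply]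
    | succ n ih =>
      rw [Function.iterate_succ_apply', ih, hsucc, H.map_comp, Category.assoc,
        ← Category.assoc g, hg, Category.assoc]

/-! The bilimit of the initial sequence of an enriched endofunctor. -/

section Bilimit

variable (H : CpoFunctor κ (PointedCpo.{u} κ) (PointedCpo.{u} κ))

/-- The iterates of an endofunctor on the zero object. -/
def iter : ℕ → PointedCpo.{u} κ
  | 0 => unit κ
  | n + 1 => H.obj (iter n)

/-- The canonical embeddings and projections between the iterates. -/
def trans : ∀ n m : ℕ, iter H n ⟶ iter H m
  | 0, _ => zero _ _
  | _ + 1, 0 => zero _ _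
  | n + 1, m + 1 => H.map (trans n m)

theorem trans_self (n : ℕ) : trans H n n = 𝟙 _ := by
  induction n with
  | zero => exact eq_of_to_unit _ _
  | succ n ih => exact (congrArg H.map ih).trans (H.map_id _)

/-- A detour through a low stage `m` can only lose information. Away from stage 0 all three maps are
images under `H`, which is monotone on morphisms, so induction applies. -/
theorem trans_comp_le (l m n : ℕ) : trans H l m ≫ trans H m n ≤ trans H l n := by
  induction m generalizing l n with
  | zero =>
    rw [show trans H 0 n = zero _ _ by rw [trans], comp_zero]
    exact zero_le _
  | succ m ih =>
    cases l with
    | zero => rw [trans, zero_comp]; exact zero_le _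
    | succ l =>
      cases n with
      | zero => exact (eq_of_to_unit _ _).le
      | succ n =>
        refine le_of_eq_of_le (H.map_comp _ _).symm ?_
        exact (H.cont _ _).monotone (ih l n)

theorem trans_comp {m n : ℕ} (l : ℕ) (h : n ≤ m) : trans H l m ≫ trans H m n = trans H l n := by
  induction m generalizing l n with
  | zero =>
    obtain rfl : n = 0 := by omega
    exact eq_of_to_unit _ _
  | succ m ih =>
    cases l with
    | zero => rw [trans, zero_comp, trans]
    | succ l =>
      cases n with
      | zero => exact eq_of_to_unit _ _
      | succ n => exact (H.map_comp _ _).symm.trans (congrArg H.map (ih l (by omega)))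

/-- The elements of the limit of the iterates along the projections. -/
abbrev BilimCarrier : Type u :=
  {x : ∀ n, (iter H n).carrier // ∀ n, (trans H (n + 1) n).toFun (x (n + 1)) = x n}

/-- Componentwise suprema remain compatible because the projections preserve them. -/
theorem BilimCarrier.exists_pointwise {s : Set (BilimCarrier H)} (hs : κ.IsChainSet s) :
    ∃ a : BilimCarrier H, ∀ n, IsLUB ((fun x : BilimCarrier H => x.1 n) '' s) (a.1 n) := by
  have hmono : ∀ n, Monotone fun x : BilimCarrier H => x.1 n := fun n _ _ h => h n
  choose a ha using fun n => (iter H n).complete _ (hs.image (hmono n))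
  refine ⟨⟨a, fun n => IsLUB.unique ?_ (ha n)⟩, ha⟩
  have h := (trans H (n + 1) n).cont.isLUB_image _ (hs.image (hmono (n + 1))) _ (ha (n + 1))
  rw [Set.image_image] at h
  rwa [Set.image_congr fun x _ => x.2 n] at h

theorem BilimCarrier.isLUB_of_pointwise {s : Set (BilimCarrier H)} {a : BilimCarrier H}
    (h : ∀ n, IsLUB ((fun x : BilimCarrier H => x.1 n) '' s) (a.1 n)) : IsLUB s a := by
  refine ⟨fun x hx n => (h n).1 ⟨x, hx, rfl⟩, fun b hb n => (h n).2 ?_⟩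
  rintro _ ⟨x, hx, rfl⟩
  exact hb hx n

/-- The limit of the iterates along the projections. -/
def bilim : PointedCpo.{u} κ where
  carrier := BilimCarrier H
  bot :=
    { bot := ⟨fun _ => ⊥, fun n => (trans H (n + 1) n).strict⟩
      bot_le := fun _ _ => bot_le }
  complete s hs := by
    obtain ⟨a, ha⟩ := BilimCarrier.exists_pointwise H hs
    exact ⟨a, BilimCarrier.isLUB_of_pointwise H ha⟩

/-- The projections from the limit. -/
def bilimProj (n : ℕ) : bilim H ⟶ iter H n :=
  Hom.mk (fun x => x.1 n)
    { monotone := fun _ _ h => h n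
      isLUB_image := fun s hs a ha => by
        obtain ⟨b, hb⟩ := BilimCarrier.exists_pointwise H (s := s) hs
        rw [ha.unique (BilimCarrier.isLUB_of_pointwise H hb)]
        exact hb n } rfl

variable {H} in
/-- The morphism into the limit induced by a cone. -/
def bilimLift {A : PointedCpo.{u} κ} (f : ∀ n, A ⟶ iter H n)
    (hf : ∀ n, f (n + 1) ≫ trans H (n + 1) n = f n) : A ⟶ bilim H :=
  Hom.mk (fun x => ⟨fun n => (f n).toFun x, fun n => congrFun (congrArg Hom.toFun (hf n)) x⟩)
    { monotone := fun _ _ h n => (f n).cont.monotone h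
      isLUB_image := fun s hs a ha => BilimCarrier.isLUB_of_pointwise H
          (s := (fun x => (⟨fun n => (f n).toFun x,
            fun n => congrFun (congrArg Hom.toFun (hf n)) x⟩ : BilimCarrier H)) '' s) fun n => by
        rw [Set.image_image]
        exact (f n).cont.isLUB_image s hs a ha }
    (Subtype.ext (funext fun n => (f n).strict))

theorem bilim_hom_ext {A : PointedCpo.{u} κ} {f g : A ⟶ bilim H}
    (h : ∀ n, f ≫ bilimProj H n = g ≫ bilimProj H n) : f = g :=
  Hom.ext (funext fun x => Subtype.ext (funext fun n =>
    congrFun (congrArg Hom.toFun (h n)) x))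

theorem bilim_hom_le {A : PointedCpo.{u} κ} {f g : A ⟶ bilim H}
    (h : ∀ n, f ≫ bilimProj H n ≤ g ≫ bilimProj H n) : f ≤ g :=
  fun x n => h n x

theorem bilimProj_comp_trans {m n : ℕ} (h : m ≤ n) :
    bilimProj H n ≫ trans H n m = bilimProj H m := by
  induction n, h using Nat.le_induction with
  | base => rw [trans_self, Category.comp_id]
  | succ n h ih =>
    have hn : bilimProj H (n + 1) ≫ trans H (n + 1) n = bilimProj H n :=
      Hom.ext (funext fun x => x.2 n)
    rw [← trans_comp H (n + 1) h, ← Category.assoc, hn, ih]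

/-- The embeddings into the limit. -/
def bilimIncl (n : ℕ) : iter H n ⟶ bilim H :=
  bilimLift (trans H n) fun m => trans_comp H n m.le_succ

theorem bilimIncl_comp_proj (n m : ℕ) : bilimIncl H n ≫ bilimProj H m = trans H n m :=
  rfl

/-- The canonical approximations of the identity of the limit. -/
def bilimApprox (n : ℕ) : bilim H ⟶ bilim H :=
  bilimProj H n ≫ bilimIncl H n

theorem bilimApprox_zero : bilimApprox H 0 = zero _ _ := by
  have h : bilimProj H 0 = zero _ _ := eq_of_to_unit _ _
  rw [bilimApprox, h, zero_comp]

theorem bilimApprox_monotone : Monotone (bilimApprox H) := by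
  refine monotone_nat_of_le_succ fun n => bilim_hom_le H fun m => ?_
  rw [bilimApprox, bilimApprox, Category.assoc, Category.assoc, bilimIncl_comp_proj,
    bilimIncl_comp_proj, ← bilimProj_comp_trans H n.le_succ, Category.assoc]
  exact CpoCategory.comp_le_comp (κ := κ) le_rfl (trans_comp_le H _ _ _)

/-- The `m`-th component of the `n`-th approximation is already exact once `m ≤ n`. -/
theorem isLUB_bilimApprox : IsLUB (Set.range (bilimApprox H)) (𝟙 (bilim H)) := by
  have key : ∀ {m n : ℕ}, m ≤ n → bilimApprox H n ≫ bilimProj H m = bilimProj H m := by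
    intro m n h
    rw [bilimApprox, Category.assoc, bilimIncl_comp_proj, bilimProj_comp_trans H h]
  constructor
  · rintro _ ⟨n, rfl⟩
    refine bilim_hom_le H fun m => ?_
    rw [Category.id_comp]
    refine le_of_le_of_eq ?_ (key (le_max_right n m))
    exact CpoCategory.comp_le_comp (κ := κ) (bilimApprox_monotone H (le_max_left n m)) le_rfl
  · intro f hf
    refine bilim_hom_le H fun m => ?_
    rw [Category.id_comp]
    refine le_of_eq_of_le (key le_rfl).symm ?_
    exact CpoCategory.comp_le_comp (κ := κ) (hf ⟨m, rfl⟩) le_rfl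

/-- The structure morphism of the limit as an algebra. -/
def bilimStr : H.obj (bilim H) ⟶ bilim H :=
  bilimLift (fun n => match n with
    | 0 => zero _ _
    | n + 1 => H.map (bilimProj H n)) fun n => by
      cases n with
      | zero => exact eq_of_to_unit _ _
      | succ n =>
        exact (H.map_comp _ _).symm.trans (congrArg H.map (bilimProj_comp_trans H n.le_succ))

theorem bilimStr_comp_proj (n : ℕ) :
    bilimStr H ≫ bilimProj H (n + 1) = H.map (bilimProj H n) :=
  rfl

/-- With `bilimStr_comp_proj`, this shows that conjugating `H` of an approximation by the structure
map gives the next approximation. -/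
theorem map_bilimIncl_comp_str (n : ℕ) :
    H.map (bilimIncl H n) ≫ bilimStr H = bilimIncl H (n + 1) := by
  refine bilim_hom_ext H fun m => ?_
  cases m with
  | zero => exact eq_of_to_unit _ _
  | succ m =>
    rw [Category.assoc, bilimStr_comp_proj]
    exact (H.map_comp _ _).symm

/-- The terms of the chain whose supremum is the inverse of the structure morphism. -/
def bilimInvApprox (n : ℕ) : bilim H ⟶ H.obj (bilim H) :=
  bilimProj H (n + 1) ≫ H.map (bilimIncl H n)

theorem bilimInvApprox_monotone : Monotone (bilimInvApprox H) := by
  refine monotone_nat_of_le_succ fun n => ?_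
  have hn : H.map (trans H (n + 1) n) ≫ H.map (bilimIncl H n) ≤ H.map (bilimIncl H (n + 1)) := by
    rw [← H.map_comp]
    exact (H.cont _ _).monotone (bilim_hom_le H fun m => trans_comp_le H _ _ _)
  have h := CpoCategory.comp_le_comp (κ := κ) (le_refl (bilimProj H (n + 2))) hn
  rw [bilimInvApprox, ← bilimProj_comp_trans H (n + 1).le_succ]
  exact le_of_eq_of_le (Category.assoc _ _ _) h

theorem exists_bilimIso : ∃ ω : H.obj (bilim H) ≅ bilim H, ω.hom = bilimStr H := by
  obtain ⟨j, hj⟩ := CpoCategory.complete (κ := κ) _ _ _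
    (κ.isChainSet_range (bilimInvApprox_monotone H))
  refine ⟨⟨bilimStr H, j, ?_, ?_⟩, rfl⟩
  -- The terms become `H.map (bilimApprox H n)`; continuity of `H` on morphisms gives supremum
  -- `H.map (𝟙 _)`.
  · have h := (CpoCategory.comp_right (κ := κ) (bilimStr H)).isLUB_range
      (bilimInvApprox_monotone H) hj
    refine h.unique ?_
    have h' := (H.cont _ _).isLUB_range (bilimApprox_monotone H) (isLUB_bilimApprox H)
    rw [H.map_id] at h'
    convert h' using 3 with n
    exact (H.map_comp (bilimProj H n) (bilimIncl H n)).symm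
  -- Here the terms become `bilimApprox H (n + 1)`; dropping the first approximation leaves the
  -- supremum unchanged.
  · have h := (CpoCategory.comp_left (κ := κ) (bilimStr H)).isLUB_range
      (bilimInvApprox_monotone H) hj
    refine h.unique ?_
    convert (isLUB_range_succ (bilimApprox_monotone H)).2 (isLUB_bilimApprox H) using 3 with n
    rw [bilimApprox, ← map_bilimIncl_comp_str]
    exact Category.assoc _ _ _

theorem isAlgebraicallyCompact : IsAlgebraicallyCompact H.toFunctor := by
  obtain ⟨ω, hω⟩ := exists_bilimIso H
  refine isAlgebraicallyCompact_of_isLUB H ω (bilimApprox H) (bilimApprox_monotone H)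
    (bilimApprox_zero H) (fun n => ?_) (isLUB_bilimApprox H)
  rw [Iso.eq_inv_comp, bilimApprox, bilimApprox, H.map_comp, Category.assoc, hω,
    map_bilimIncl_comp_str, ← bilimStr_comp_proj]
  exact (Category.assoc _ _ _).symm

end Bilimit

/-! ### Factoring lifting through pointed cpo's, and the corollary -/

/-- Lifting, as a functor into pointed cpo's. -/
def lift (κ : ChainType) : CpoFunctor κ (Cpo.{u} κ) (PointedCpo.{u} κ) where
  obj X := ⟨WithBot X.carrier, X.complete.withBot⟩
  map f := ⟨WithBot.map f.toFun, f.cont.withBot_map, rfl⟩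
  map_id _ := Hom.ext WithBot.map_id
  map_comp f g := Hom.ext (WithBot.map_comp_map f.toFun g.toFun).symm
  cont X Y :=
    { monotone := ((liftingFunctor κ).cont X Y).monotone
      isLUB_image := fun s hs g hg => isLUB_of_pointwise fun x => by
        have h := Cpo.isLUB_pointwise (hs.image ((liftingFunctor κ).cont X Y).monotone)
          (((liftingFunctor κ).cont X Y).isLUB_image s hs g hg) x
        rw [Set.image_image] at h ⊢
        exact h }

/-- The inclusion of pointed cpo's into cpo's. -/
def forget (κ : ChainType) : CpoFunctor κ (PointedCpo.{u} κ) (Cpo.{u} κ) where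
  obj X := ⟨X.carrier, X.complete⟩
  map f := ⟨f.toFun, f.cont⟩
  map_id _ := rfl
  map_comp _ _ := rfl
  cont X Y :=
    { monotone := fun _ _ h => h
      isLUB_image := fun s hs g hg => Cpo.isLUB_of_pointwise fun x => by
        rw [Set.image_image]
        exact isLUB_pointwise hs hg x }

end PointedCpo

theorem liftingFunctor_factorsThrough (κ : ChainType) :
    (liftingFunctor.{u} κ).FactorsThrough (PointedCpo.{u} κ) :=
  ⟨PointedCpo.lift κ, PointedCpo.forget κ, ⟨Iso.refl _⟩⟩

theorem CpoFunctor.FactorsThrough.algebraicallyCompact {κ : ChainType}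
    {T : CpoFunctor κ (Cpo.{u} κ) (Cpo.{u} κ)} (hT : T.FactorsThrough (PointedCpo.{u} κ)) :
    T.AlgebraicallyCompact := by
  obtain ⟨F, G, ⟨α⟩⟩ := hT
  exact IsAlgebraicallyCompact.of_iso α
    (PointedCpo.isAlgebraicallyCompact (G.comp F)).comp_swap

theorem mainTheorem6 (κ : ChainType) :
    (∀ T : CpoFunctor κ (Cpo.{u} κ) (Cpo.{u} κ),
      T.FactorsThrough (PointedCpo.{u} κ) → T.AlgebraicallyCompact) ∧
    (liftingFunctor.{u} κ).AlgebraicallyCompact :=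
  ⟨fun _ hT => hT.algebraicallyCompact, (liftingFunctor_factorsThrough κ).algebraicallyCompact⟩
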